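/- Let $X$ be a real or complex Banach space and let $(\Omega,\Sigma,\mu)$ be a measure space with $\mu$ finite. A \emph{partition} of a measurable set $A\subset\Omega$ is a sequence $\Pi=\{\Delta_i\}_{i=1}^\infty$ of pairwise disjoint measurable sets (some possibly empty) with union $A$. A partition $\Gamma=\{D_i\}$ of $A$ is \emph{finer} than a partition $\Pi=\{E_k\}$ of $A$ if $\mathbb N$ is a disjoint union of sets $I_k$, $k\in\mathbb N$, such that $E_k=\bigcup_{i\in I_k}D_i$ for all $k$. A set of sampling points for $\Gamma$ is a choice $T$ of a point $t_i\in D_i$ for each $i$ with $D_i\neq\emptyset$, and $S(f,\Gamma,T)=\sum_{i:\,D_i\ne\emptyset} f(t_i)\mu(D_i)$. A function $f:\Omega\to X$ is \emph{RL-integrable over $A$ with integral} $x\in X$, written $x=(RL)\int_A f\,d\mu$, if for every $\epsilon>0$ there is a partition $\Pi$ of $A$ such that for every partition $\Gamma$ of $A$ finer than $\Pi$ and every set $T$ of sampling points for $\Gamma$ the series $S(f,\Gamma,T)$ converges absolutely and $\|S(f,\Gamma,T)-x\|<\epsilon$. The function $f$ is \emph{RL-integrable} if it is RL-integrable over $\Omega$.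 A \emph{Bochner-integrable equivalent} of $f$ is a Bochner-integrable function $g:\Omega\to X$ such that for every $A\in\Sigma$ the RL-integral of $f$ over $A$ exists and $$(RL)\int_A f\,d\mu=(\mathrm{Bochner})\int_A g\,d\mu .$$ \textbf{Theorem.} Suppose that every separable subspace of $X$ is contained in a separable complemented subspace of $X$. Then every RL-integrable function $f:\Omega\to X$ has a Bochner-integrable equivalent. Moreover, every weakly compactly generated $X$ (that is, every $X$ containing a weakly compact set whose linear span is dense in $X$) has the property that each separable subspace is contained in a separable complemented subspace; in particular, the conclusion holds for every such $X$. -/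

import Mathlib

open MeasureTheory

noncomputable section

/-- A partition of the set `A` into a countable number of measurable subsets, indexed by `ℕ`.
Cells may be empty, so that finite partitions are included. -/
structure CountablePartition {Ω : Type*} [MeasurableSpace Ω] (A : Set Ω) where
  cell : ℕ → Set Ω
  measurableSet_cell : ∀ i, MeasurableSet (cell i)
  disjoint_cell : ∀ i j, i ≠ j → Disjoint (cell i) (cell j)
  iUnion_cell : (⋃ i, cell i) = A

namespace CountablePartition

variable {Ω : Type*} [MeasurableSpace Ω] {A : Set Ω}

/-- `Γ.Follows P` (written `Γ ≻ P`): the index set `ℕ` is the disjoint union of sets `I k`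
such that each cell `P.cell k` is the union of the cells `Γ.cell i` with `i ∈ I k`. -/
def Follows (Γ P : CountablePartition A) : Prop :=
  ∃ I : ℕ → Set ℕ, (∀ j k, j ≠ k → Disjoint (I j) (I k)) ∧ (⋃ k, I k) = Set.univ ∧
    ∀ k, P.cell k = ⋃ i ∈ I k, Γ.cell i

/-- A choice of sampling points: one point in each cell (empty cells carry none). -/
abbrev Sampling (P : CountablePartition A) : Type _ :=
  ∀ i : {i : ℕ // (P.cell i).Nonempty}, P.cell i

end CountablePartition

section RL

variable {Ω X : Type*} [MeasurableSpace Ω] [NormedAddCommGroup X] [NormedSpace ℝ X]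

/-- The `i`-th term `μ(Δ i) • f (t i)` of the integral sum `S(f, P, T)`. -/
def rlTerm (μ : Measure Ω) (f : Ω → X) {A : Set Ω} (P : CountablePartition A) (T : P.Sampling)
    (i : {i : ℕ // (P.cell i).Nonempty}) : X :=
  μ.real (P.cell i) • f (T i)

/-- The Riemann-Lebesgue integral sum `S(f, P, T)`; it is only used together with the
absolute convergence of the series. -/
def rlSum (μ : Measure Ω) (f : Ω → X) {A : Set Ω} (P : CountablePartition A)
    (T : P.Sampling) : X :=
  ∑' i, rlTerm μ f P T i

/-- `x` is the Riemann-Lebesgue integral of `f` over `A`. -/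
def HasRLIntegral (μ : Measure Ω) (f : Ω → X) (A : Set Ω) (x : X) : Prop :=
  ∀ ε : ℝ, 0 < ε → ∃ P : CountablePartition A, ∀ Γ : CountablePartition A, Γ.Follows P →
    ∀ T : Γ.Sampling, (Summable fun i => ‖rlTerm μ f Γ T i‖) ∧ ‖rlSum μ f Γ T - x‖ < ε

/-- `f` is Riemann-Lebesgue integrable over `A`. -/
def RLIntegrableOn (μ : Measure Ω) (f : Ω → X) (A : Set Ω) : Prop :=
  ∃ x : X, HasRLIntegral μ f A x

/-- `f` is Riemann-Lebesgue integrable (over the whole space). -/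
def RLIntegrable (μ : Measure Ω) (f : Ω → X) : Prop :=
  RLIntegrableOn μ f Set.univ

/-- `g` is a Bochner-integrable equivalent of `f`: `g` is Bochner integrable and over every
measurable set the Riemann-Lebesgue integral of `f` exists and equals the Bochner integral
of `g`. -/
def IsBochnerEquivalent (μ : Measure Ω) (f g : Ω → X) : Prop :=
  Integrable g μ ∧ ∀ A : Set Ω, MeasurableSet A → HasRLIntegral μ f A (∫ t in A, g t ∂μ)

end RL

section Spaces

variable (𝕜 X : Type*) [RCLike 𝕜] [NormedAddCommGroup X] [NormedSpace 𝕜 X]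

/-- Every separable subspace of `X` is contained in a separable complemented subspace. -/
def SeparablyComplemented : Prop :=
  ∀ Z : Submodule 𝕜 X, TopologicalSpace.IsSeparable (Z : Set X) →
    ∃ Y : Submodule 𝕜 X, Z ≤ Y ∧ TopologicalSpace.IsSeparable (Y : Set X) ∧ Y.ClosedComplemented

/-- `X` is weakly compactly generated: a weakly compact set has dense linear span. -/
def IsWCG : Prop :=
  ∃ K : Set X, IsCompact (toWeakSpace 𝕜 X '' K) ∧ Dense (Submodule.span 𝕜 K : Set X)

end Spaces

end

/-! For an RL-integrable `f`, take partitions `P n` with tolerance `(1/2)^n`, and let `f_n` be the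
step function with one sampled value of `f` per cell. Given a real functional `ψ`, choose two
samplings so that `ψ` of their difference is nonnegative on every cell: subtracting the two integral
sums bounds the total `ψ`-oscillation of `f` over `P n` by `2 * (1/2)^n * ‖ψ‖`
(`tsum_measure_mul_osc_le`). Hence `ψ ∘ f` is a.e. measurable, and `f_n` approximates `f` weakly in
L¹, uniformly over the dual ball.

The values of all `f_n` span a separable subspace; let `Q` project onto a separable complemented
subspace containing it. Then `Q ∘ f` is strongly measurable by Pettis' theorem, and integrable
because `f` is dominated by its cellwise suprema. As `Q` fixes the values of `f_n`, `φ (f_n - Q f) =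
(φ ∘ Q) (f_n - f)`, so the integrals of `f_n` over each measurable set converge to those of `Q ∘ f`.
Integral sums over finer partitions are close to the integrals of `f_n` by the same oscillation
bound.

In the weakly compactly generated case, take a countable set `A` with closed span `Y` and let `V` be
the common kernel of functionals norming the points of `A`. If `A` is rich enough, weak compactness
gives `K ⊆ Y + V`, while norming makes the sum direct and closed. -/

/-! ### Separable complemented subspaces of weakly compactly generated spaces -/

section SeparableComplements

variable {𝕜 X : Type*} [RCLike 𝕜] [NormedAddCommGroup X] [NormedSpace 𝕜 X]

/-- A closed subspace is weakly closed. -/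
theorem Submodule.isClosed_image_toWeakSpace (Y : Submodule 𝕜 X) (hY : IsClosed (Y : Set X)) :
    IsClosed (toWeakSpace 𝕜 X '' (Y : Set X)) := by
  let _ : NormedSpace ℝ X := NormedSpace.restrictScalars ℝ 𝕜 X
  have : IsScalarTower ℝ 𝕜 X := inferInstance
  have hc : Convex ℝ (Y : Set X) := (Y.restrictScalars ℝ).convex
  have h := hc.toWeakSpace_closure (𝕜 := 𝕜)
  rw [hY.closure_eq] at h
  rw [h]
  exact isClosed_closure

theorem continuous_dual_toWeakSpace_symm (φ : StrongDual 𝕜 X) :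
    Continuous fun w : WeakSpace 𝕜 X => φ ((toWeakSpace 𝕜 X).symm w) :=
  WeakBilin.eval_continuous (topDualPairing 𝕜 X).flip φ

/-- If the values of a family of functionals at `k` can be approximated by values at points of the
weakly compact set `K ∩ Y`, then they are attained at a point of `K ∩ Y`. -/
theorem exists_mem_inter_forall_eq {K : Set X} (hK : IsCompact (toWeakSpace 𝕜 X '' K))
    (Y : Submodule 𝕜 X) (hY : IsClosed (Y : Set X)) {ι : Type*} (φ : ι → StrongDual 𝕜 X) (k : X)
    (h : ∀ F : Finset ι, ∀ ε : ℝ, 0 < ε → ∃ a ∈ K, a ∈ Y ∧ ∀ c ∈ F, ‖φ c a - φ c k‖ < ε) :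
    ∃ a ∈ K, a ∈ Y ∧ ∀ c, φ c a = φ c k := by
  classical
  have hKY : IsCompact (toWeakSpace 𝕜 X '' K ∩ toWeakSpace 𝕜 X '' (Y : Set X)) :=
    hK.inter_right (Y.isClosed_image_toWeakSpace hY)
  let t : ι × ℕ → Set (WeakSpace 𝕜 X) := fun i =>
    {w | ‖φ i.1 ((toWeakSpace 𝕜 X).symm w) - φ i.1 k‖ ≤ 1 / ((i.2 : ℝ) + 1)}
  have ht : ∀ i, IsClosed (t i) := fun i =>
    isClosed_le ((continuous_dual_toWeakSpace_symm (φ i.1)).sub continuous_const).norm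
      continuous_const
  obtain ⟨w, ⟨⟨a, haK, rfl⟩, ⟨b, hbY, hab⟩⟩, hw⟩ := hKY.inter_iInter_nonempty t ht (by
    intro u
    obtain ⟨a, haK, haY, ha⟩ := h (u.image Prod.fst) (1 / (((u.sup Prod.snd : ℕ) : ℝ) + 1))
      (by positivity)
    refine ⟨toWeakSpace 𝕜 X a, ⟨⟨a, haK, rfl⟩, ⟨a, haY, rfl⟩⟩, ?_⟩
    simp only [Set.mem_iInter]
    intro i hi
    change ‖φ i.1 ((toWeakSpace 𝕜 X).symm (toWeakSpace 𝕜 X a)) - φ i.1 k‖ ≤ _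
    rw [LinearEquiv.symm_apply_apply]
    refine (ha i.1 (Finset.mem_image_of_mem _ hi)).le.trans ?_
    have : (i.2 : ℝ) ≤ (u.sup Prod.snd : ℕ) := by
      exact_mod_cast Finset.le_sup (f := Prod.snd) hi
    gcongr)
  have hba : b = a := (toWeakSpace 𝕜 X).injective hab
  refine ⟨a, haK, hba ▸ hbY, fun c => ?_⟩
  have hle : ∀ n : ℕ, ‖φ c a - φ c k‖ ≤ 1 / ((n : ℝ) + 1) := fun n => by
    have := Set.mem_iInter.1 hw (c, n)
    change ‖φ c ((toWeakSpace 𝕜 X).symm (toWeakSpace 𝕜 X a)) - φ c k‖ ≤ _ at this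
    rwa [LinearEquiv.symm_apply_apply] at this
  have h0 : ‖φ c a - φ c k‖ ≤ 0 :=
    ge_of_tendsto' tendsto_one_div_add_atTop_nhds_zero_nat hle
  exact sub_eq_zero.1 (norm_le_zero_iff.1 h0)

/-- Countably many functionals are simultaneously approximated on `K` by a countable subset. -/
theorem exists_countable_subset_forall_approx (K : Set X) (ν : X → StrongDual 𝕜 X) {A : Set X}
    (hA : A.Countable) :
    ∃ κ ⊆ K, κ.Countable ∧ ∀ F : Finset X, ↑F ⊆ A → ∀ ε : ℝ, 0 < ε → ∀ k ∈ K,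
      ∃ a ∈ κ, ∀ c ∈ F, ‖ν c a - ν c k‖ < ε := by
  have : Countable A := hA.to_subtype
  -- Since `A` is countable, `A → 𝕜` is second countable, so the image of `K` is separable; a
  -- condition on finitely many coordinates is open there.
  let q : K → (A → 𝕜) := fun k c => ν c k
  obtain ⟨s, hs, hd⟩ := TopologicalSpace.exists_countable_dense (Set.range q)
  choose p hp using fun y : Set.range q => y.2
  refine ⟨(fun y => (p y : X)) '' s, ?_, hs.image _, ?_⟩
  · rintro _ ⟨y, -, rfl⟩
    exact (p y).2
  intro F hF ε hε k hk
  let U : Set (Set.range q) := {y | ∀ c : F, ‖y.1 ⟨c, hF c.2⟩ - ν c k‖ < ε}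
  have hU : IsOpen U := by
    simp only [U, Set.ofPred_forall]
    refine isOpen_iInter_of_finite fun c => isOpen_lt ?_ continuous_const
    exact (((continuous_apply _).comp continuous_subtype_val).sub continuous_const).norm
  obtain ⟨y, hys, hyU⟩ := hd.exists_mem_open hU ⟨⟨q ⟨k, hk⟩, ⟨_, rfl⟩⟩, fun c => by simpa [q]⟩
  refine ⟨p y, ⟨y, hys, rfl⟩, fun c hc => ?_⟩
  have := hyU ⟨c, hc⟩
  rw [← hp y] at this
  exact this

theorem exists_countable_subset_span_dense (A : Set X) (hA : A.Countable) :
    ∃ D : Set X, D.Countable ∧ (Submodule.span 𝕜 A : Set X) ⊆ closure D := by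
  obtain ⟨D, -, hD⟩ :=
    (hA.isSeparable.span (R := 𝕜)).exists_countable_dense_subset
  exact ⟨D, hD⟩

/-- A countable set containing `A₀`, dense in its linear span, and rich enough for
finitely many functionals `ν c` with `c` in the set. -/
theorem exists_countable_rich_set (K : Set X) (ν : X → StrongDual 𝕜 X) {A₀ : Set X}
    (hA₀ : A₀.Countable) :
    ∃ A : Set X, A.Countable ∧ A₀ ⊆ A ∧ (Submodule.span 𝕜 A : Set X) ⊆ closure A ∧
      ∀ F : Finset X, ↑F ⊆ A → ∀ ε : ℝ, 0 < ε → ∀ k ∈ K,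
        ∃ a ∈ K, a ∈ A ∧ ∀ c ∈ F, ‖ν c a - ν c k‖ < ε := by
  classical
  choose κ hκK hκc hκ using fun A : {A : Set X // A.Countable} =>
    exists_countable_subset_forall_approx K ν A.2
  choose D hDc hD using fun A : {A : Set X // A.Countable} =>
    exists_countable_subset_span_dense (𝕜 := 𝕜) A.1 A.2
  -- Closing-off: each stage adds the approximating points and a set dense in the span of the
  -- previous stage. A finite subset of the union lies in one stage, so the next stage serves it.
  let S : ℕ → {A : Set X // A.Countable} := fun n =>
    Nat.rec ⟨A₀, hA₀⟩ (fun _ A => ⟨A.1 ∪ κ A ∪ D A, (A.2.union (hκc A)).union (hDc A)⟩) n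
  have hS : ∀ n, (S (n + 1)).1 = (S n).1 ∪ κ (S n) ∪ D (S n) := fun n => rfl
  have hmono : Monotone fun n => (S n).1 := monotone_nat_of_le_succ fun n => by
    rw [hS]
    exact fun x hx => Or.inl (Or.inl hx)
  refine ⟨⋃ n, (S n).1, Set.countable_iUnion fun n => (S n).2,
    Set.subset_iUnion (fun n => (S n).1) 0, ?_, ?_⟩
  · rw [Submodule.span_iUnion]
    have hdir : Directed (· ≤ ·) fun n => Submodule.span 𝕜 (S n).1 :=
      (show Monotone fun n => Submodule.span 𝕜 (S n).1 from
        fun m n h => Submodule.span_mono (hmono h)).directed_le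
    rw [Submodule.coe_iSup_of_directed _ hdir]
    refine Set.iUnion_subset fun n => (hD (S n)).trans (closure_mono ?_)
    refine Set.Subset.trans ?_ (Set.subset_iUnion (fun n => (S n).1) (n + 1))
    rw [hS]
    exact Set.subset_union_right
  · intro F hF ε hε k hk
    obtain ⟨n, hn⟩ := (hmono.directed_le).exists_mem_subset_of_finset_subset_biUnion hF
    obtain ⟨a, ha, h⟩ := hκ (S n) F hn ε hε k hk
    refine ⟨a, hκK _ ha, Set.mem_iUnion.2 ⟨n + 1, ?_⟩, h⟩
    rw [hS]
    exact Or.inl (Or.inr ha)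

/-- For `y` in `A`, the functional norming `y` does not see `v`; the inequality then passes to the
closure. -/
theorem norm_le_norm_add_of_norming {A : Set X} {ν : X → StrongDual 𝕜 X}
    (hν : ∀ x, ‖ν x‖ ≤ 1 ∧ ν x x = ‖x‖) {y v : X} (hy : y ∈ closure A)
    (hv : ∀ a ∈ A, ν a v = 0) : ‖y‖ ≤ ‖y + v‖ := by
  have hcl : IsClosed {y : X | ‖y‖ ≤ ‖y + v‖} := isClosed_le (by fun_prop) (by fun_prop)
  refine hcl.closure_subset_iff.2 (fun a ha => ?_) hy
  have h : ‖ν a (a + v)‖ = ‖a‖ := by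
    rw [map_add, hv a ha, add_zero, (hν a).2]
    simp
  calc ‖a‖ = ‖ν a (a + v)‖ := h.symm
    _ ≤ ‖ν a‖ * ‖a + v‖ := (ν a).le_opNorm _
    _ ≤ 1 * ‖a + v‖ := by gcongr; exact (hν a).1
    _ = ‖a + v‖ := one_mul _

/-- Closed subspaces `Y`, `V` with `‖y‖ ≤ ‖y + v‖` and dense sum are complementary. -/
theorem isCompl_of_norm_le_norm_add [CompleteSpace X] {Y V : Submodule 𝕜 X}
    (hY : IsClosed (Y : Set X)) (hV : IsClosed (V : Set X))
    (h : ∀ y ∈ Y, ∀ v ∈ V, ‖y‖ ≤ ‖y + v‖) (hd : Dense ((Y ⊔ V : Submodule 𝕜 X) : Set X)) :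
    IsCompl Y V := by
  have : CompleteSpace Y := hY.completeSpace_coe
  have : CompleteSpace V := hV.completeSpace_coe
  refine ⟨Submodule.disjoint_def.2 fun x hx hx' => ?_, codisjoint_iff.2 ?_⟩
  · have := h x hx (-x) (V.neg_mem hx')
    rw [add_neg_cancel, norm_zero] at this
    exact norm_le_zero_iff.1 this
  let L : Y × V →L[𝕜] X := Y.subtypeL.coprod V.subtypeL
  -- The constant 2 comes from `‖v‖ ≤ ‖y + v‖ + ‖y‖ ≤ 2 * ‖y + v‖`. Completeness then makes the sum
  -- closed.
  have hL : AntilipschitzWith 2 L := by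
    refine AddMonoidHomClass.antilipschitz_of_bound L fun p => ?_
    have h1 := h p.1 p.1.2 p.2 p.2.2
    have h2 : ‖(p.2 : X)‖ ≤ ‖(p.1 : X) + p.2‖ + ‖(p.1 : X)‖ := by
      simpa using norm_sub_le ((p.1 : X) + p.2) p.1
    have h3 : L p = (p.1 : X) + p.2 := rfl
    rw [h3, Prod.norm_def, max_le_iff]
    simp only [Submodule.coe_norm, NNReal.coe_ofNat]
    constructor <;> linarith [norm_nonneg (p.1 : X)]
  have hcl : IsClosed (Set.range L) := hL.isClosed_range L.uniformContinuous
  have hr : Set.range L = ((Y ⊔ V : Submodule 𝕜 X) : Set X) := by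
    ext x
    simp only [Set.mem_range, SetLike.mem_coe, Submodule.mem_sup]
    constructor
    · rintro ⟨p, rfl⟩
      exact ⟨p.1, p.1.2, p.2, p.2.2, rfl⟩
    · rintro ⟨y, hy, v, hv, rfl⟩
      exact ⟨(⟨y, hy⟩, ⟨v, hv⟩), rfl⟩
  rw [hr] at hcl
  exact SetLike.coe_injective (by rw [← hcl.closure_eq, hd.closure_eq]; rfl)

/-- In a weakly compactly generated Banach space, every separable subspace is contained in a
separable complemented subspace. -/
theorem IsWCG.separablyComplemented [CompleteSpace X] (hX : IsWCG 𝕜 X) :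
    SeparablyComplemented 𝕜 X := by
  obtain ⟨K, hK, hKd⟩ := hX
  intro Z hZ
  obtain ⟨A₀, hA₀Z, hA₀, hZA₀⟩ := hZ.exists_countable_dense_subset
  choose ν hν using fun x : X => exists_dual_vector'' 𝕜 x
  obtain ⟨A, hA, hA₀A, hspan, hrich⟩ := exists_countable_rich_set (𝕜 := 𝕜) K ν hA₀
  let Y : Submodule 𝕜 X := (Submodule.span 𝕜 A).topologicalClosure
  let V : Submodule 𝕜 X := ⨅ a : A, (ν a).ker
  have hYc : IsClosed (Y : Set X) := Submodule.isClosed_topologicalClosure _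
  have hVc : IsClosed (V : Set X) := by
    rw [Submodule.coe_iInf]
    exact isClosed_iInter fun a => (ν a).isClosed_ker
  have hYA : (Y : Set X) ⊆ closure A := by
    rw [Submodule.topologicalClosure_coe]
    exact closure_minimal hspan isClosed_closure
  have hAY : A ⊆ Y := Submodule.subset_span.trans (Submodule.le_topologicalClosure _)
  -- Split `k = a + (k - a)`, where `a ∈ K ∩ Y` has the same values as `k` under all the norming
  -- functionals.
  have hKYV : K ⊆ (Y ⊔ V : Submodule 𝕜 X) := by
    intro k hk
    obtain ⟨a, -, haY, ha⟩ := exists_mem_inter_forall_eq hK Y hYc (fun c : A => ν c) k (by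
      classical
      intro F ε hε
      obtain ⟨a, haK, haA, ha⟩ := hrich (F.image Subtype.val) (by simp) ε hε k hk
      exact ⟨a, haK, hAY haA, fun c hc => ha c (Finset.mem_image_of_mem _ hc)⟩)
    refine Submodule.mem_sup.2 ⟨a, haY, k - a, ?_, by simp⟩
    refine (Submodule.mem_iInf _).2 fun c => ?_
    rw [LinearMap.mem_ker]
    simp [ha c]
  have hcompl : IsCompl Y V := by
    refine isCompl_of_norm_le_norm_add hYc hVc (fun y hy v hv => ?_)
      (hKd.mono (Submodule.span_le.2 hKYV))
    refine norm_le_norm_add_of_norming hν (hYA hy) fun a ha => ?_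
    exact (Submodule.mem_iInf _).1 hv ⟨a, ha⟩
  refine ⟨Y, ?_, ?_, .of_isCompl_isClosed hcompl hYc hVc⟩
  · exact hZA₀.trans (closure_minimal (hA₀A.trans hAY) hYc)
  · exact hA.isSeparable.closure.mono hYA

end SeparableComplements

/-! ### Pettis' measurability theorem -/

section Pettis

variable {Ω X : Type*} [MeasurableSpace Ω] [NormedAddCommGroup X] [NormedSpace ℝ X]

/-- The functional norming a nearby `d` almost norms `y`: `ν d y ≥ ‖y‖ - 2 * ‖y - d‖`. -/
theorem norm_le_of_forall_norming_le {D : Set X} {ν : X → StrongDual ℝ X}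
    (hν : ∀ x, ‖ν x‖ ≤ 1 ∧ ν x x = ‖x‖) {y : X} (hy : y ∈ closure D) {r : ℝ}
    (h : ∀ d ∈ D, ‖ν d y‖ ≤ r) : ‖y‖ ≤ r := by
  refine le_of_forall_pos_le_add fun ε hε => ?_
  obtain ⟨d, hd, hyd⟩ := Metric.mem_closure_iff.1 hy (ε / 2) (half_pos hε)
  rw [dist_eq_norm] at hyd
  have h1 : ‖d‖ = ν d y - ν d (y - d) := by
    rw [map_sub, (hν d).2]
    simp
  have h2 : ‖ν d (y - d)‖ ≤ ‖y - d‖ := by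
    simpa using (ν d).le_of_opNorm_le (hν d).1 (y - d)
  have h3 : ‖y‖ ≤ ‖y - d‖ + ‖d‖ := by simpa using norm_add_le (y - d) d
  have h4 := (le_abs_self (ν d y)).trans (h d hd)
  have h5 := (neg_abs_le (ν d (y - d)))
  rw [Real.norm_eq_abs] at h2
  linarith

/-- Pettis' measurability theorem: a separably valued, weakly measurable function is strongly
measurable. -/
theorem aestronglyMeasurable_of_forall_dual {μ : Measure Ω} {g : Ω → X} {s : Set X}
    (hs : TopologicalSpace.IsSeparable s) (hgs : ∀ t, g t ∈ s)
    (hg : ∀ φ : StrongDual ℝ X, AEMeasurable (fun t => φ (g t)) μ) :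
    AEStronglyMeasurable g μ := by
  borelize X
  refine aestronglyMeasurable_iff_nullMeasurable_separable.2
    ⟨?_, s, hs, Filter.Eventually.of_forall hgs⟩
  let Y : Submodule ℝ X := Submodule.span ℝ s
  obtain ⟨D, hDY, hD, hYD⟩ := (hs.span (R := ℝ)).exists_countable_dense_subset
  choose ν hν using fun x : X => exists_dual_vector'' ℝ x
  have hball : ∀ c ∈ D, ∀ r : ℝ, NullMeasurableSet (g ⁻¹' Metric.closedBall c r) μ := by
    intro c hc r
    -- The differences `g t - c` must be approximated from `D`, which is why `D` is dense in the
    -- span of `s` and not merely in `s`.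
    have : g ⁻¹' Metric.closedBall c r = ⋂ d ∈ D, {t | ‖ν d (g t) - ν d c‖ ≤ r} := by
      ext t
      simp only [Set.mem_preimage, Metric.mem_closedBall, dist_eq_norm, Set.mem_iInter,
        Set.mem_ofPred_eq, ← map_sub]
      refine ⟨fun h d _ => ?_, fun h => norm_le_of_forall_norming_le hν (hYD ?_) h⟩
      · refine le_trans ?_ h
        simpa using (ν d).le_of_opNorm_le (hν d).1 (g t - c)
      · exact Y.sub_mem (Submodule.subset_span (hgs t)) (hDY hc)
    rw [this]
    refine NullMeasurableSet.biInter hD fun d _ => nullMeasurableSet_le ?_ aemeasurable_const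
    exact ((hg (ν d)).sub_const _).norm
  have hopen : ∀ U : Set X, IsOpen U → NullMeasurableSet (g ⁻¹' U) μ := by
    intro U hU
    have : g ⁻¹' U = ⋃ c ∈ D, ⋃ q : ℚ, ⋃ _ : Metric.closedBall c (q : ℝ) ⊆ U,
        g ⁻¹' Metric.closedBall c (q : ℝ) := by
      ext t
      simp only [Set.mem_preimage, Set.mem_iUnion, exists_prop]
      refine ⟨fun ht => ?_, fun ⟨c, _, q, hq, h⟩ => hq h⟩
      obtain ⟨ρ, hρ, hρU⟩ := Metric.isOpen_iff.1 hU _ ht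
      obtain ⟨q, hq0, hq⟩ := exists_rat_btwn (half_pos hρ)
      obtain ⟨c, hc, hgc⟩ := Metric.mem_closure_iff.1 (hYD (Submodule.subset_span (hgs t))) q hq0
      refine ⟨c, hc, q, fun z hz => hρU ?_, hgc.le⟩
      have h1 := dist_triangle_right z (g t) c
      rw [Metric.mem_closedBall] at hz
      rw [Metric.mem_ball]
      linarith
    rw [this]
    exact NullMeasurableSet.biUnion hD fun c hc => NullMeasurableSet.iUnion fun q =>
      NullMeasurableSet.iUnion fun _ => hball c hc q
  exact fun s hs => (measurable_of_isOpen (γ := X) (δ := NullMeasurableSpace Ω μ) (f := g) hopen) hs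

end Pettis

/-- A selection can be altered at one index at a time, so finitely many suprema may be taken in
turn. This turns bounds valid for every sampling into bounds on cellwise suprema. -/
theorem ENNReal.tsum_iSup_le_of_forall_tsum_le {ι : Type*} {α : ι → Type*} [∀ i, Nonempty (α i)]
    (b : ∀ i, α i → ENNReal) {C : ENNReal} (h : ∀ s : ∀ i, α i, ∑' i, b i (s i) ≤ C) :
    ∑' i, ⨆ a, b i a ≤ C := by
  classical
  -- `F` holds the indices where the supremum is already taken; in the induction an index is moved
  -- into `G` with an arbitrary value.
  have key : ∀ F G : Finset ι, Disjoint F G → ∀ s : ∀ i, α i,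
      ∑ i ∈ F, (⨆ a, b i a) + ∑ i ∈ G, b i (s i) ≤ C := by
    intro F
    induction F using Finset.induction_on with
    | empty =>
      intro G _ s
      simpa using (ENNReal.sum_le_tsum G).trans (h s)
    | insert j F hj ih =>
      intro G hG s
      rw [Finset.disjoint_insert_left] at hG
      rw [Finset.sum_insert hj, add_assoc, ENNReal.iSup_add]
      refine iSup_le fun a => ?_
      have h1 := ih (insert j G) (Finset.disjoint_insert_right.2 ⟨hj, hG.2⟩)
        (Function.update s j a)
      rw [Finset.sum_insert hG.1, Function.update_self] at h1
      have h2 : ∑ i ∈ G, b i (Function.update s j a i) = ∑ i ∈ G, b i (s i) :=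
        Finset.sum_congr rfl fun i hi => by
          rw [Function.update_of_ne (ne_of_mem_of_not_mem hi hG.1)]
      rw [h2] at h1
      rwa [add_left_comm]
  rw [ENNReal.tsum_eq_iSup_sum]
  refine iSup_le fun F => ?_
  simpa using key F ∅ (Finset.disjoint_empty_right F) (fun i => Classical.arbitrary _)

/-! ### Partitions, their index functions and sampled step functions -/

namespace CountablePartition

variable {Ω X : Type*} [MeasurableSpace Ω] {A : Set Ω}

theorem measurableSet (P : CountablePartition A) : MeasurableSet A := by
  have h := MeasurableSet.iUnion P.measurableSet_cell
  rwa [P.iUnion_cell] at h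

theorem follows_refl (P : CountablePartition A) : P.Follows P := by
  refine ⟨fun k => {k}, fun j k h => by simpa using h, ?_, fun k => by simp⟩
  ext k
  simp

open Classical in
/-- The index of the cell containing a point (and `0` outside of the partitioned set). -/
noncomputable def index (P : CountablePartition A) (ω : Ω) : ℕ :=
  if h : ∃ i, ω ∈ P.cell i then h.choose else 0

theorem mem_cell_index (P : CountablePartition A) {ω : Ω} (hω : ω ∈ A) :
    ω ∈ P.cell (P.index ω) := by
  rw [← P.iUnion_cell, Set.mem_iUnion] at hω
  rw [index, dif_pos hω]
  exact hω.choose_spec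

theorem cell_subset (P : CountablePartition A) (i : ℕ) : P.cell i ⊆ A :=
  (Set.subset_iUnion _ i).trans P.iUnion_cell.subset

theorem index_eq (P : CountablePartition A) {ω : Ω} {i : ℕ} (hω : ω ∈ P.cell i) :
    P.index ω = i := by
  by_contra h
  exact Set.disjoint_left.1 (P.disjoint_cell _ _ h) (P.mem_cell_index (P.cell_subset i hω)) hω

theorem measurable_index (P : CountablePartition A) : Measurable P.index := by
  refine measurable_to_countable' fun i => ?_
  -- The default value `0` outside `A` adds `Aᶜ` to the fibre over `0`.
  have h : P.index ⁻¹' {i} = P.cell i ∪ (if i = 0 then Aᶜ else ∅) := by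
    ext ω
    rw [Set.mem_preimage, Set.mem_singleton_iff, Set.mem_union]
    constructor
    · intro hi
      by_cases hω : ω ∈ A
      · exact Or.inl (hi ▸ P.mem_cell_index hω)
      · right
        have h0 : P.index ω = 0 := by
          rw [index, dif_neg]
          rintro ⟨j, hj⟩
          exact hω (P.cell_subset j hj)
        rw [if_pos (hi.symm.trans h0)]
        exact hω
    · rintro (hω | hω)
      · exact P.index_eq hω
      · split_ifs at hω with hi
        · rw [index, dif_neg, hi]
          rintro ⟨j, hj⟩
          exact hω (P.cell_subset j hj)
        · exact hω.elim
  rw [h]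
  refine (P.measurableSet_cell i).union ?_
  split_ifs
  · exact P.measurableSet.compl
  · exact MeasurableSet.empty

theorem setLIntegral_index (P : CountablePartition A) (μ : Measure Ω) (m : ℕ → ENNReal) :
    ∫⁻ ω in A, m (P.index ω) ∂μ = ∑' i, μ (P.cell i) * m i := by
  have h := lintegral_iUnion (μ := μ) P.measurableSet_cell
    (fun i j h => P.disjoint_cell i j h) (fun ω => m (P.index ω))
  rw [P.iUnion_cell] at h
  rw [h]
  refine tsum_congr fun i => ?_
  rw [setLIntegral_congr_fun (g := fun _ => m i) (P.measurableSet_cell i)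
    (fun ω hω => by simp only [P.index_eq hω]), setLIntegral_const, mul_comm]

theorem hasSum_setIntegral_index [NormedAddCommGroup X] [NormedSpace ℝ X] [CompleteSpace X]
    (P : CountablePartition A) (μ : Measure Ω) [IsFiniteMeasure μ] {v : ℕ → X}
    (hv : IntegrableOn (fun ω => v (P.index ω)) A μ) :
    HasSum (fun i => μ.real (P.cell i) • v i) (∫ ω in A, v (P.index ω) ∂μ) := by
  have hv' : IntegrableOn (fun ω => v (P.index ω)) (⋃ i, P.cell i) μ := by
    rwa [P.iUnion_cell]
  have h := hasSum_integral_iUnion P.measurableSet_cell (fun i j h => P.disjoint_cell i j h) hv'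
  rw [P.iUnion_cell] at h
  convert h using 2 with i
  rw [setIntegral_congr_fun (g := fun _ => v i) (P.measurableSet_cell i)
    (fun ω hω => by simp only [P.index_eq hω]), setIntegral_const]

open Classical in
/-- The sampled value of `f` in the `i`-th cell (and `0` if the cell is empty). -/
noncomputable def value [Zero X] {P : CountablePartition A} (f : Ω → X) (T : P.Sampling) (i : ℕ) :
    X :=
  if h : (P.cell i).Nonempty then f (T ⟨i, h⟩) else 0

theorem value_of_nonempty [Zero X] {P : CountablePartition A} (f : Ω → X) (T : P.Sampling)
    (i : {i : ℕ // (P.cell i).Nonempty}) : value f T i = f (T i) :=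
  dif_pos i.2

theorem value_eq_of_mem [Zero X] {P : CountablePartition A} (f : Ω → X) (T : P.Sampling)
    {ω : Ω} (hω : ω ∈ A) :
    ∃ s ∈ P.cell (P.index ω), value f T (P.index ω) = f s :=
  ⟨_, (T ⟨P.index ω, ⟨ω, P.mem_cell_index hω⟩⟩).2, value_of_nonempty f T ⟨P.index ω, _⟩⟩

section Sum

variable [NormedAddCommGroup X] [NormedSpace ℝ X] {μ : Measure Ω} [IsFiniteMeasure μ]

theorem hasSum_rlTerm [CompleteSpace X] {P : CountablePartition A} {f : Ω → X} {T : P.Sampling}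
    (h : IntegrableOn (fun ω => value f T (P.index ω)) A μ) :
    HasSum (rlTerm μ f P T) (∫ ω in A, value f T (P.index ω) ∂μ) := by
  have h1 := P.hasSum_setIntegral_index μ h
  have hsupp : Function.support (fun i => μ.real (P.cell i) • value f T i) ⊆
      {i | (P.cell i).Nonempty} := by
    intro i hi
    by_contra hne
    rw [Set.mem_ofPred_eq, Set.not_nonempty_iff_eq_empty] at hne
    simp [hne] at hi
  rw [← hasSum_subtype_iff_of_support_subset hsupp] at h1
  have h2 : rlTerm μ f P T = (fun i => μ.real (P.cell i) • value f T i) ∘ Subtype.val :=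
    funext fun i => congrArg (μ.real (P.cell i) • ·) (value_of_nonempty f T i).symm
  rw [h2]
  exact h1

theorem summable_norm_rlTerm {P : CountablePartition A} {f : Ω → X} {T : P.Sampling}
    (h : IntegrableOn (fun ω => value f T (P.index ω)) A μ) :
    Summable fun i => ‖rlTerm μ f P T i‖ := by
  have h1 := P.hasSum_setIntegral_index μ (v := fun i => ‖value f T i‖) h.norm
  have h2 := h1.summable.comp_injective (i := Subtype.val (p := fun i => (P.cell i).Nonempty))
    Subtype.val_injective
  refine h2.congr fun i => ?_
  simp only [rlTerm, Function.comp, norm_smul, value_of_nonempty f T i, smul_eq_mul,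
    Real.norm_of_nonneg measureReal_nonneg]

end Sum

/-! ### Oscillation and supremum bounds on the cells -/

section Oscillation

variable [NormedAddCommGroup X]

/-- The supremum of `‖f‖` on the `i`-th cell. -/
noncomputable def supNorm (P : CountablePartition A) (f : Ω → X) (i : ℕ) : ENNReal :=
  ⨆ s : P.cell i, ‖f s‖ₑ

theorem enorm_le_supNorm (P : CountablePartition A) (f : Ω → X) {i : ℕ}
    {s : Ω} (hs : s ∈ P.cell i) : ‖f s‖ₑ ≤ P.supNorm f i :=
  le_iSup (fun s : P.cell i => ‖f s‖ₑ) ⟨s, hs⟩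

variable [NormedSpace ℝ X]

/-- The oscillation of `ψ ∘ f` on the `i`-th cell. -/
noncomputable def osc (P : CountablePartition A) (f : Ω → X) (ψ : StrongDual ℝ X) (i : ℕ) :
    ENNReal :=
  ⨆ p : P.cell i × P.cell i, ‖ψ (f p.1 - f p.2)‖ₑ

theorem enorm_le_osc (P : CountablePartition A) (f : Ω → X) (ψ : StrongDual ℝ X) {i : ℕ}
    {s t : Ω} (hs : s ∈ P.cell i) (ht : t ∈ P.cell i) :
    ‖ψ (f s - f t)‖ₑ ≤ P.osc f ψ i :=
  le_iSup (fun p : P.cell i × P.cell i => ‖ψ (f p.1 - f p.2)‖ₑ) (⟨s, hs⟩, ⟨t, ht⟩)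

theorem tsum_measure_cell_mul (P : CountablePartition A) (μ : Measure Ω) (m : ℕ → ENNReal) :
    ∑' i, μ (P.cell i) * m i =
      ∑' i : {i : ℕ // (P.cell i).Nonempty}, μ (P.cell i) * m i := by
  refine (tsum_subtype_eq_of_support_subset (s := {i | (P.cell i).Nonempty})
    (f := fun i => μ (P.cell i) * m i) fun i hi => ?_).symm
  by_contra hne
  rw [Set.mem_ofPred_eq, Set.not_nonempty_iff_eq_empty] at hne
  simp [hne] at hi

variable {μ : Measure Ω} [IsFiniteMeasure μ] {P : CountablePartition A} {f : Ω → X} {x : X} {ε : ℝ}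

/-- The sign condition removes the absolute values: the sum is `ψ` of a difference of two integral
sums, each within `ε` of `x`. -/
theorem tsum_measure_mul_enorm_le [CompleteSpace X]
    (hP : ∀ T : P.Sampling, (Summable fun i => ‖rlTerm μ f P T i‖) ∧ ‖rlSum μ f P T - x‖ < ε)
    (ψ : StrongDual ℝ X) (S T : P.Sampling) (hST : ∀ i, 0 ≤ ψ (f (S i) - f (T i))) :
    ∑' i : {i : ℕ // (P.cell i).Nonempty}, μ (P.cell i) * ‖ψ (f (S i) - f (T i))‖ₑ ≤
      ENNReal.ofReal (2 * ε * ‖ψ‖) := by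
  have hS := (hP S).1.of_norm.hasSum
  have hT := (hP T).1.of_norm.hasSum
  have hd : HasSum (fun i : {i : ℕ // (P.cell i).Nonempty} =>
      μ.real (P.cell i) * ψ (f (S i) - f (T i))) (ψ (rlSum μ f P S - rlSum μ f P T)) := by
    refine (ψ.hasSum (hS.sub hT)).congr_fun fun i => ?_
    simp only [rlTerm, ← smul_sub, map_smul, smul_eq_mul]
  have hnn : ∀ i : {i : ℕ // (P.cell i).Nonempty},
      0 ≤ μ.real (P.cell i) * ψ (f (S i) - f (T i)) :=
    fun i => mul_nonneg measureReal_nonneg (hST i)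
  have heq : ∀ i : {i : ℕ // (P.cell i).Nonempty},
      μ (P.cell i) * ‖ψ (f (S i) - f (T i))‖ₑ =
        ENNReal.ofReal (μ.real (P.cell i) * ψ (f (S i) - f (T i))) := fun i => by
    rw [ENNReal.ofReal_mul measureReal_nonneg, ofReal_measureReal,
      Real.enorm_eq_ofReal (hST i)]
  rw [tsum_congr heq, ← ENNReal.ofReal_tsum_of_nonneg hnn hd.summable, hd.tsum_eq]
  refine ENNReal.ofReal_le_ofReal ?_
  have h1 : ‖rlSum μ f P S - rlSum μ f P T‖ ≤ 2 * ε := by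
    have := norm_sub_le (rlSum μ f P S - x) (rlSum μ f P T - x)
    rw [sub_sub_sub_cancel_right] at this
    linarith [(hP S).2, (hP T).2]
  calc ψ (rlSum μ f P S - rlSum μ f P T) ≤ ‖ψ (rlSum μ f P S - rlSum μ f P T)‖ := le_abs_self _
    _ ≤ ‖ψ‖ * ‖rlSum μ f P S - rlSum μ f P T‖ := ψ.le_opNorm _
    _ ≤ ‖ψ‖ * (2 * ε) := by gcongr
    _ = 2 * ε * ‖ψ‖ := mul_comm _ _

theorem tsum_measure_mul_osc_le [CompleteSpace X]
    (hP : ∀ T : P.Sampling, (Summable fun i => ‖rlTerm μ f P T i‖) ∧ ‖rlSum μ f P T - x‖ < ε)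
    (ψ : StrongDual ℝ X) :
    ∑' i, μ (P.cell i) * P.osc f ψ i ≤ ENNReal.ofReal (2 * ε * ‖ψ‖) := by
  rw [tsum_measure_cell_mul]
  simp only [osc, ENNReal.mul_iSup]
  have : ∀ i : {i : ℕ // (P.cell i).Nonempty}, Nonempty (P.cell i × P.cell i) := fun i =>
    ⟨⟨i.2.some, i.2.some_mem⟩, ⟨i.2.some, i.2.some_mem⟩⟩
  refine ENNReal.tsum_iSup_le_of_forall_tsum_le _ fun p => ?_
  -- Swapping the two points of a cell where needed achieves the sign condition without changing
  -- absolute values.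
  have hch : ∀ i : {i : ℕ // (P.cell i).Nonempty}, ∃ q : P.cell i × P.cell i,
      0 ≤ ψ (f q.1 - f q.2) ∧ ‖ψ (f (p i).1 - f (p i).2)‖ₑ = ‖ψ (f q.1 - f q.2)‖ₑ := fun i => by
    rcases le_total 0 (ψ (f (p i).1 - f (p i).2)) with h | h
    · exact ⟨p i, h, rfl⟩
    · refine ⟨(p i).swap, ?_, ?_⟩
      · rw [← neg_sub, map_neg]
        simpa using h
      · rw [← neg_sub, map_neg, enorm_neg]
        rfl
  choose q hq hpq using hch
  rw [tsum_congr fun i => by rw [hpq i]]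
  exact tsum_measure_mul_enorm_le hP ψ (fun i => (q i).1) (fun i => (q i).2) hq

theorem measure_mul_enorm_sub_le [CompleteSpace X]
    (hP : ∀ T : P.Sampling, (Summable fun i => ‖rlTerm μ f P T i‖) ∧ ‖rlSum μ f P T - x‖ < ε)
    {i : ℕ} {s t : Ω} (hs : s ∈ P.cell i) (ht : t ∈ P.cell i) :
    μ.real (P.cell i) * ‖f s - f t‖ ≤ 2 * max ε 0 := by
  rw [← Real.norm_of_nonneg (measureReal_nonneg (μ := μ) (s := P.cell i)), ← norm_smul]
  refine NormedSpace.norm_le_dual_bound ℝ _ (by positivity) fun ψ => ?_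
  have h1 : μ (P.cell i) * ‖ψ (f s - f t)‖ₑ ≤ ENNReal.ofReal (2 * max ε 0 * ‖ψ‖) :=
    calc _ ≤ μ (P.cell i) * P.osc f ψ i := by gcongr; exact P.enorm_le_osc f ψ hs ht
      _ ≤ _ := ENNReal.le_tsum i
      _ ≤ _ := tsum_measure_mul_osc_le hP ψ
      _ ≤ _ := ENNReal.ofReal_le_ofReal (by gcongr; exact le_max_left _ _)
  rw [← ofReal_measureReal, ← ofReal_norm, ← ENNReal.ofReal_mul measureReal_nonneg] at h1
  have h2 := (ENNReal.ofReal_le_ofReal_iff (by positivity)).1 h1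
  rwa [map_smul, norm_smul, Real.norm_of_nonneg measureReal_nonneg]

/-- Only the product is controlled: on a null cell `f` may be unbounded. -/
theorem measure_mul_supNorm_lt_top [CompleteSpace X]
    (hP : ∀ T : P.Sampling, (Summable fun i => ‖rlTerm μ f P T i‖) ∧ ‖rlSum μ f P T - x‖ < ε)
    (i : {i : ℕ // (P.cell i).Nonempty}) :
    μ (P.cell i) * P.supNorm f i < ⊤ := by
  obtain ⟨t, ht⟩ := i.2
  have hle : μ (P.cell i) * P.supNorm f i ≤
      ENNReal.ofReal (2 * max ε 0 + μ.real (P.cell i) * ‖f t‖) := by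
    rw [supNorm, ENNReal.mul_iSup]
    refine iSup_le fun s => ?_
    rw [← ofReal_measureReal, ← ofReal_norm, ← ENNReal.ofReal_mul measureReal_nonneg]
    refine ENNReal.ofReal_le_ofReal ?_
    have h1 := measure_mul_enorm_sub_le hP s.2 ht
    have h2 : ‖f s‖ ≤ ‖f s - f t‖ + ‖f t‖ := by simpa using norm_add_le (f s - f t) (f t)
    calc μ.real (P.cell i) * ‖f s‖ ≤ μ.real (P.cell i) * (‖f s - f t‖ + ‖f t‖) := by gcongr
      _ ≤ _ := by rw [mul_add]; gcongr
  exact hle.trans_lt ENNReal.ofReal_lt_top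

/-- Sample so that each weighted supremum is attained up to a summable error; absolute convergence
for this single sampling suffices. The result supplies the integrable majorant. -/
theorem tsum_measure_mul_supNorm_ne_top [CompleteSpace X]
    (hP : ∀ T : P.Sampling, (Summable fun i => ‖rlTerm μ f P T i‖) ∧ ‖rlSum μ f P T - x‖ < ε) :
    ∑' i, μ (P.cell i) * P.supNorm f i ≠ ⊤ := by
  rw [tsum_measure_cell_mul]
  obtain ⟨δ, hδ, hδs⟩ := ENNReal.exists_pos_sum_of_countable one_ne_zero
    {i : ℕ // (P.cell i).Nonempty}
  have hch : ∀ i : {i : ℕ // (P.cell i).Nonempty}, ∃ s : P.cell i,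
      μ (P.cell i) * P.supNorm f i ≤ μ (P.cell i) * ‖f s‖ₑ + δ i := fun i => by
    by_contra! hcon
    have : Nonempty (P.cell i) := i.2.to_subtype
    have hle : μ (P.cell i) * P.supNorm f i + δ i ≤ μ (P.cell i) * P.supNorm f i := by
      conv_lhs => rw [supNorm, ENNReal.mul_iSup, ENNReal.iSup_add]
      exact iSup_le fun s => (hcon s).le
    exact (ENNReal.lt_add_right (measure_mul_supNorm_lt_top hP i).ne
      (ENNReal.coe_ne_zero.2 (hδ i).ne')).not_ge hle
  choose T hT using hch
  refine ne_top_of_le_ne_top ?_ (ENNReal.tsum_le_tsum hT)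
  rw [ENNReal.tsum_add]
  refine ENNReal.add_ne_top.2 ⟨?_, (hδs.trans ENNReal.one_lt_top).ne⟩
  have h1 : ∀ i : {i : ℕ // (P.cell i).Nonempty},
      μ (P.cell i) * ‖f (T i)‖ₑ = ENNReal.ofReal ‖rlTerm μ f P T i‖ := fun i => by
    rw [rlTerm, norm_smul, Real.norm_of_nonneg measureReal_nonneg,
      ENNReal.ofReal_mul measureReal_nonneg, ofReal_measureReal, ofReal_norm]
  rw [tsum_congr h1, ← ENNReal.ofReal_tsum_of_nonneg (fun _ => norm_nonneg _) (hP T).1]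
  exact ENNReal.ofReal_ne_top

end Oscillation

/-- The trace of a partition of `Ω` on a measurable set. -/
def restrict (P : CountablePartition (Set.univ : Set Ω)) (hA : MeasurableSet A) :
    CountablePartition A where
  cell i := P.cell i ∩ A
  measurableSet_cell i := (P.measurableSet_cell i).inter hA
  disjoint_cell i j h := (P.disjoint_cell i j h).mono Set.inter_subset_left Set.inter_subset_left
  iUnion_cell := by rw [← Set.iUnion_inter, P.iUnion_cell, Set.univ_inter]

theorem Follows.cell_index_subset {Γ : CountablePartition A}
    {P : CountablePartition (Set.univ : Set Ω)} {hA : MeasurableSet A}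
    (h : Γ.Follows (P.restrict hA)) {ω : Ω} (hω : ω ∈ A) :
    Γ.cell (Γ.index ω) ⊆ P.cell (P.index ω) := by
  obtain ⟨I, -, hI, hcell⟩ := h
  obtain ⟨k, hk⟩ : ∃ k, Γ.index ω ∈ I k := by
    simpa using Set.ext_iff.1 hI (Γ.index ω)
  have hsub : Γ.cell (Γ.index ω) ⊆ P.cell k := by
    refine Set.Subset.trans ?_ (Set.inter_subset_left (t := A))
    change _ ⊆ (P.restrict hA).cell k
    rw [hcell k]
    exact Set.subset_biUnion_of_mem hk
  rwa [P.index_eq (hsub (Γ.mem_cell_index hω))]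

end CountablePartition

theorem CountablePartition.aestronglyMeasurable_value {Ω X : Type*} [MeasurableSpace Ω]
    [NormedAddCommGroup X] {μ : Measure Ω} {A : Set Ω} {Γ : CountablePartition A}
    (f : Ω → X) (T : Γ.Sampling) : AEStronglyMeasurable (fun ω => value f T (Γ.index ω)) μ :=
  ((StronglyMeasurable.of_discrete (f := value f T)).comp_measurable
    Γ.measurable_index).aestronglyMeasurable

/-! ### Construction of the Bochner-integrable equivalent -/

section BochnerEquivalent

variable {Ω X : Type*} [MeasurableSpace Ω] [NormedAddCommGroup X] [NormedSpace ℝ X]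
  {μ : Measure Ω}

/-- Oscillation is controlled only after applying a functional, but uniformly over the dual ball,
which is enough to bound the norm of an integral. -/
theorem norm_setIntegral_sub_le_of_dual [CompleteSpace X] {A : Set Ω} {u v : Ω → X}
    (hu : IntegrableOn u A μ) (hv : IntegrableOn v A μ) {C : ℝ} (hC : 0 ≤ C)
    (h : ∀ φ : StrongDual ℝ X, ∫⁻ ω in A, ‖φ (u ω - v ω)‖ₑ ∂μ ≤ ENNReal.ofReal (C * ‖φ‖)) :
    ‖∫ ω in A, u ω ∂μ - ∫ ω in A, v ω ∂μ‖ ≤ C := by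
  refine NormedSpace.norm_le_dual_bound ℝ _ hC fun φ => ?_
  have h0 := φ.integral_comp_comm (hu.sub hv)
  simp only [Pi.sub_apply] at h0
  rw [← integral_sub hu hv, ← h0]
  have h1 := (enorm_integral_le_lintegral_enorm (μ := μ.restrict A)
    fun ω => φ (u ω - v ω)).trans (h φ)
  rw [← ofReal_norm] at h1
  exact (ENNReal.ofReal_le_ofReal_iff (by positivity)).1 h1

variable [IsFiniteMeasure μ]

namespace CountablePartition

variable {P : CountablePartition (Set.univ : Set Ω)} {f : Ω → X} {x : X} {ε : ℝ}

theorem integrableOn_of_enorm_le_supNorm [CompleteSpace X]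
    (hP : ∀ T : P.Sampling, (Summable fun i => ‖rlTerm μ f P T i‖) ∧ ‖rlSum μ f P T - x‖ < ε)
    {A : Set Ω} (hA : MeasurableSet A) {u : Ω → X} (hu : AEStronglyMeasurable u μ)
    {c : ENNReal} (hc : c ≠ ⊤) (h : ∀ ω ∈ A, ‖u ω‖ₑ ≤ c * P.supNorm f (P.index ω)) :
    IntegrableOn u A μ := by
  refine ⟨hu.restrict, ?_⟩
  have hm : Measurable fun ω => P.supNorm f (P.index ω) :=
    (Measurable.of_discrete (f := P.supNorm f)).comp P.measurable_index
  have h1 := tsum_measure_mul_supNorm_ne_top hP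
  rw [← P.setLIntegral_index, Measure.restrict_univ] at h1
  calc ∫⁻ ω in A, ‖u ω‖ₑ ∂μ ≤ ∫⁻ ω in A, c * P.supNorm f (P.index ω) ∂μ :=
        setLIntegral_mono' hA h
    _ ≤ ∫⁻ ω, c * P.supNorm f (P.index ω) ∂μ := setLIntegral_le_lintegral _ _
    _ = c * ∫⁻ ω, P.supNorm f (P.index ω) ∂μ := lintegral_const_mul _ hm
    _ < ⊤ := ENNReal.mul_lt_top hc.lt_top h1.lt_top

theorem integrableOn_value [CompleteSpace X]
    (hP : ∀ T : P.Sampling, (Summable fun i => ‖rlTerm μ f P T i‖) ∧ ‖rlSum μ f P T - x‖ < ε)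
    {A : Set Ω} (hA : MeasurableSet A) {Γ : CountablePartition A} (T : Γ.Sampling)
    (hΓ : ∀ ω ∈ A, Γ.cell (Γ.index ω) ⊆ P.cell (P.index ω)) :
    IntegrableOn (fun ω => value f T (Γ.index ω)) A μ := by
  refine integrableOn_of_enorm_le_supNorm hP hA (aestronglyMeasurable_value f T)
    ENNReal.one_ne_top fun ω hω => ?_
  obtain ⟨s, hs, hv⟩ := value_eq_of_mem f T hω
  rw [hv, one_mul]
  exact P.enorm_le_supNorm f (hΓ ω hω hs)

theorem setLIntegral_le_of_le_osc [CompleteSpace X]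
    (hP : ∀ T : P.Sampling, (Summable fun i => ‖rlTerm μ f P T i‖) ∧ ‖rlSum μ f P T - x‖ < ε)
    {A : Set Ω} (hA : MeasurableSet A) (ψ : StrongDual ℝ X) {w : Ω → ENNReal}
    (h : ∀ ω ∈ A, w ω ≤ P.osc f ψ (P.index ω)) :
    ∫⁻ ω in A, w ω ∂μ ≤ ENNReal.ofReal (2 * ε * ‖ψ‖) :=
  calc ∫⁻ ω in A, w ω ∂μ ≤ ∫⁻ ω in A, P.osc f ψ (P.index ω) ∂μ := setLIntegral_mono' hA h
    _ ≤ ∫⁻ ω in Set.univ, P.osc f ψ (P.index ω) ∂μ := lintegral_mono_set (Set.subset_univ A)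
    _ = ∑' i, μ (P.cell i) * P.osc f ψ i := P.setLIntegral_index μ _
    _ ≤ _ := tsum_measure_mul_osc_le hP ψ

end CountablePartition

open CountablePartition

/-- An `RL`-integrable function (given by a sequence of witnessing partitions) is weakly a.e.
measurable. -/
theorem aemeasurable_dual_of_tight_partitions [CompleteSpace X] {f : Ω → X} {x : X}
    (P : ℕ → CountablePartition (Set.univ : Set Ω))
    (hP : ∀ n, ∀ T : (P n).Sampling, (Summable fun i => ‖rlTerm μ f (P n) T i‖) ∧
      ‖rlSum μ f (P n) T - x‖ < (1 / 2) ^ n)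
    (T : ∀ n, (P n).Sampling) (ψ : StrongDual ℝ X) : AEMeasurable (fun ω => ψ (f ω)) μ := by
  have hm : ∀ n, Measurable fun ω => (P n).osc f ψ ((P n).index ω) := fun n =>
    (Measurable.of_discrete (f := (P n).osc f ψ)).comp (P n).measurable_index
  have hsum : ∑' n, ∫⁻ ω, (P n).osc f ψ ((P n).index ω) ∂μ ≠ ⊤ := by
    have hle : ∀ n, ∫⁻ ω, (P n).osc f ψ ((P n).index ω) ∂μ ≤
        ENNReal.ofReal (2 * (1 / 2) ^ n * ‖ψ‖) := fun n => by
      rw [← setLIntegral_univ]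
      exact setLIntegral_le_of_le_osc (hP n) MeasurableSet.univ ψ fun _ _ => le_rfl
    refine ne_top_of_le_ne_top ?_ (ENNReal.tsum_le_tsum hle)
    rw [← ENNReal.ofReal_tsum_of_nonneg (fun n => by positivity)
      ((summable_geometric_two.mul_left 2).mul_right _)]
    exact ENNReal.ofReal_ne_top
  rw [← lintegral_tsum fun n => (hm n).aemeasurable] at hsum
  have hae := ae_lt_top' (Measurable.tsum hm).aemeasurable hsum
  refine aemeasurable_of_tendsto_metrizable_ae'
    (f := fun n ω => ψ (value f (T n) ((P n).index ω)))
    (fun n => (ψ.continuous.comp_aestronglyMeasurable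
      (aestronglyMeasurable_value f (T n))).aemeasurable) ?_
  filter_upwards [hae] with ω hω
  -- Almost everywhere the oscillations are summable over `n`, hence tend to zero, and they bound
  -- the distance from `ψ (f ω)` to the sampled values.
  have h0 := ENNReal.tendsto_atTop_zero_of_tsum_ne_top hω.ne
  rw [tendsto_iff_edist_tendsto_0]
  refine tendsto_of_tendsto_of_tendsto_of_le_of_le tendsto_const_nhds h0 (fun _ => zero_le)
    fun n => ?_
  obtain ⟨s, hs, hv⟩ := value_eq_of_mem f (T n) (Set.mem_univ ω)
  simp only [edist_eq_enorm_sub, hv, ← map_sub]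
  exact (P n).enorm_le_osc f ψ hs ((P n).mem_cell_index (Set.mem_univ ω))

/-- If `Q` is a bounded operator with separable range fixing the values of `f` at the tags of a
sequence of partitions witnessing the `RL`-integrability of `f`, then `Q ∘ f` is a
Bochner-integrable equivalent of `f`. -/
theorem isBochnerEquivalent_comp [CompleteSpace X] {f : Ω → X} {x : X}
    (P : ℕ → CountablePartition (Set.univ : Set Ω))
    (hP : ∀ n, ∀ T : (P n).Sampling, (Summable fun i => ‖rlTerm μ f (P n) T i‖) ∧
      ‖rlSum μ f (P n) T - x‖ < (1 / 2) ^ n)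
    (T : ∀ n, (P n).Sampling) (Q : X →L[ℝ] X)
    (hQs : TopologicalSpace.IsSeparable (Set.range Q))
    (hQ : ∀ n i, Q (f (T n i)) = f (T n i)) :
    IsBochnerEquivalent μ f fun ω => Q (f ω) := by
  have hmeas : AEStronglyMeasurable (fun ω => Q (f ω)) μ :=
    aestronglyMeasurable_of_forall_dual hQs (fun ω => ⟨f ω, rfl⟩) fun φ =>
      aemeasurable_dual_of_tight_partitions P hP T (φ.comp Q)
  have hint : Integrable (fun ω => Q (f ω)) μ := by
    rw [← integrableOn_univ]
    refine integrableOn_of_enorm_le_supNorm (hP 0) MeasurableSet.univ hmeas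
      (c := ‖Q‖ₑ) enorm_ne_top fun ω hω => (Q.le_opENorm (f ω)).trans ?_
    gcongr
    exact (P 0).enorm_le_supNorm f ((P 0).mem_cell_index hω)
  refine ⟨hint, fun A hA ε hε => ?_⟩
  -- The summand `1` pays for replacing the sum over `Γ` by the integral of `f_n`, and `‖Q‖` for
  -- passing from `f_n` to `Q ∘ f`.
  obtain ⟨n, hn⟩ : ∃ n : ℕ, 2 * (1 / 2 : ℝ) ^ n * (1 + ‖Q‖) < ε := by
    obtain ⟨n, hn⟩ := exists_pow_lt_of_lt_one (x := ε / (2 * (1 + ‖Q‖))) (y := (1 / 2 : ℝ))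
      (by positivity) (by norm_num)
    refine ⟨n, ?_⟩
    rw [lt_div_iff₀ (by positivity)] at hn
    linarith
  refine ⟨(P n).restrict hA, fun Γ hΓ S => ?_⟩
  have hsub : ∀ ω ∈ A, Γ.cell (Γ.index ω) ⊆ (P n).cell ((P n).index ω) :=
    fun ω hω => hΓ.cell_index_subset hω
  have hΓint := integrableOn_value (hP n) hA S hsub
  refine ⟨summable_norm_rlTerm hΓint, ?_⟩
  have hPint : IntegrableOn (fun ω => value f (T n) ((P n).index ω)) A μ :=
    (integrableOn_value (hP n) MeasurableSet.univ (T n)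
      fun ω _ => Set.Subset.rfl).mono_set (Set.subset_univ A)
  have hmem : ∀ ω, ω ∈ (P n).cell ((P n).index ω) := fun ω =>
    (P n).mem_cell_index (Set.mem_univ ω)
  have h1 : ‖∫ ω in A, value f S (Γ.index ω) ∂μ -
      ∫ ω in A, value f (T n) ((P n).index ω) ∂μ‖ ≤ 2 * (1 / 2) ^ n := by
    refine norm_setIntegral_sub_le_of_dual hΓint hPint (by positivity) fun φ =>
      setLIntegral_le_of_le_osc (hP n) hA φ fun ω hω => ?_
    obtain ⟨s, hs, hv⟩ := value_eq_of_mem f S hω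
    obtain ⟨t, ht, hv'⟩ := value_eq_of_mem f (T n) (Set.mem_univ ω)
    rw [hv, hv']
    exact (P n).enorm_le_osc f φ (hsub ω hω hs) ht
  have h2 : ‖∫ ω in A, value f (T n) ((P n).index ω) ∂μ - ∫ ω in A, Q (f ω) ∂μ‖ ≤
      2 * (1 / 2) ^ n * ‖Q‖ := by
    refine norm_setIntegral_sub_le_of_dual hPint hint.integrableOn (by positivity) fun φ => ?_
    refine (setLIntegral_le_of_le_osc (hP n) hA (φ.comp Q) fun ω hω => ?_).trans
      (ENNReal.ofReal_le_ofReal (?_ : 2 * (1 / 2) ^ n * ‖φ.comp Q‖ ≤ _))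
    · let i : {i : ℕ // ((P n).cell i).Nonempty} := ⟨(P n).index ω, ω, hmem ω⟩
      have hv : value f (T n) ((P n).index ω) = f (T n i) := value_of_nonempty f (T n) i
      rw [hv]
      -- The sampled value is fixed by `Q`, so the difference becomes `Q` of a difference of values
      -- of `f` in one cell.
      nth_rewrite 1 [← hQ n i]
      rw [← map_sub Q]
      exact (P n).enorm_le_osc f (φ.comp Q) (T n i).2 (hmem ω)
    · calc 2 * (1 / 2) ^ n * ‖φ.comp Q‖ ≤ 2 * (1 / 2) ^ n * (‖φ‖ * ‖Q‖) := by
            gcongr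
            exact φ.opNorm_comp_le Q
        _ = _ := by ring
  rw [rlSum, (hasSum_rlTerm hΓint).tsum_eq]
  calc _ ≤ _ := norm_sub_le_norm_sub_add_norm_sub _
        (∫ ω in A, value f (T n) ((P n).index ω) ∂μ) _
    _ ≤ 2 * (1 / 2) ^ n + 2 * (1 / 2) ^ n * ‖Q‖ := add_le_add h1 h2
    _ < ε := by linarith

/-- If separable subspaces lie in separable complemented ones, every `RL`-integrable function has
a Bochner-integrable equivalent. -/
theorem RLIntegrable.exists_isBochnerEquivalent {𝕜 : Type*} [RCLike 𝕜] [NormedSpace 𝕜 X]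
    [CompleteSpace X] (hX : SeparablyComplemented 𝕜 X) {f : Ω → X} (hf : RLIntegrable μ f) :
    ∃ g : Ω → X, IsBochnerEquivalent μ f g := by
  obtain ⟨x, hx⟩ := hf
  choose P hP using fun n : ℕ => hx ((1 / 2) ^ n) (by positivity)
  replace hP := fun n => hP n (P n) (P n).follows_refl
  let T : ∀ n, (P n).Sampling := fun n i => ⟨i.2.some, i.2.some_mem⟩
  let s : Set X := ⋃ n, Set.range fun i => f (T n i)
  have hs : s.Countable := Set.countable_iUnion fun n => Set.countable_range _
  obtain ⟨Y, hZY, hY, p, hp⟩ := hX (Submodule.span 𝕜 s) hs.isSeparable.span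
  let q : X →L[𝕜] X := Y.subtypeL.comp p
  -- No compatibility between the real and `𝕜` structures is assumed; a continuous additive map is
  -- automatically real-linear.
  let Q : X →L[ℝ] X := (q : X →+ X).toRealLinearMap q.continuous
  refine ⟨_, isBochnerEquivalent_comp P hP T Q (hY.mono ?_) fun n i => ?_⟩
  · rintro _ ⟨y, rfl⟩
    exact (p y).2
  · have hmem : f (T n i) ∈ Y :=
      hZY (Submodule.subset_span (Set.mem_iUnion.2 ⟨n, i, rfl⟩))
    exact congrArg Subtype.val (hp ⟨_, hmem⟩)

end BochnerEquivalent

theorem mainTheorem7 {𝕜 X : Type*} [RCLike 𝕜] [NormedAddCommGroup X] [NormedSpace ℝ X]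
    [NormedSpace 𝕜 X] [CompleteSpace X] :
    (SeparablyComplemented 𝕜 X →
      ∀ {Ω : Type*} [MeasurableSpace Ω] (μ : Measure Ω) [IsFiniteMeasure μ] (f : Ω → X),
        RLIntegrable μ f → ∃ g : Ω → X, IsBochnerEquivalent μ f g) ∧
    (IsWCG 𝕜 X → SeparablyComplemented 𝕜 X) :=
  ⟨fun hX _ _ _ _ _ hf => hf.exists_isBochnerEquivalent hX, IsWCG.separablyComplemented⟩
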